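/- Let $\mathfrak h$ and $\mathsf k$ be complex Hilbert spaces. For $I\subset\mathbb R$ let $\mathcal F_I$ be the symmetric Fock space over $L^2(I;\mathsf k)$, with exponential vectors $\varepsilon(f)=(1,f,(2!)^{-1/2}f\otimes f,\dots)$, and let $\mathcal F_+=\mathcal F_{[0,\infty[}$. For $t\ge 0$ let $s_t$ be the isometric right shift on $L^2(\mathbb R_+;\mathsf k)$, $(s_tf)(u)=f(u-t)$ for $u\ge t$ and $(s_tf)(u)=0$ for $u<t$, and let $\sigma_t$ be the unital endomorphism of $B(\mathfrak h\otimes\mathcal F_+)$ determined by $$\langle u\,\varepsilon(f),\sigma_t(Z)\,v\,\varepsilon(g)\rangle=\langle u\,\varepsilon(s_t^*f),Z\,v\,\varepsilon(s_t^*g)\rangle\,\exp\int_0^t\langle f(r),g(r)\rangle\,dr\qquad(u,v\in\mathfrak h,\ f,g\in L^2(\mathbb R_+;\mathsf k)),$$ that is, $\sigma_t(Z)$ is the shifted copy of $Z$ on $\mathfrak h\otimes\mathcal F_{[t,\infty[}$ tensored with the identity of $\mathcal F_{[0,t[}$. A (Fock-adapted) left cocycle on $\mathfrak h\otimes\mathcal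 F_+$ is a family $X=(X_t)_{t\ge0}\subset B(\mathfrak h\otimes\mathcal F_+)$ with $X_0=I$, with $X_{r+t}=X_r\,\sigma_r(X_t)$ for all $r,t\ge0$, and with $X_t\in B(\mathfrak h\otimes\mathcal F_{[0,t[})\otimes I_{\mathcal F_{[t,\infty[}}$ for all $t\ge0$, where $\mathcal F_+\cong\mathcal F_{[0,t[}\otimes\mathcal F_{[t,\infty[}$ via $\varepsilon(f)\leftrightarrow\varepsilon(f|_{[0,t[})\otimes\varepsilon(f|_{[t,\infty[})$. **Proposition 2.1.** Let $X=(X_t)_{t\ge0}$ be a left cocycle on $\mathfrak h\otimes\mathcal F_+$ such that $X_t\to I$ in the weak operator topology as $t\to0$. Then there are constants $M,a\in\mathbb R$ such that $\|X_t\|\le Me^{at}$ for all $t\ge0$. Moreover, the map $t\mapsto X_t$ is strongly continuous on $[0,\infty[$, i.e. $t\mapsto X_t\xi$ is norm continuous for every $\xi\in\mathfrak h\otimes\mathcal F_+$. -/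

import Mathlib

open MeasureTheory Filter Topology
open scoped TensorProduct NNReal ENNReal

universe u

noncomputable section

namespace QSC

attribute [-instance] CStarModule.toInner

/-! ### Hilbert space tensor products -/

/-- The Hilbert space tensor product `E ⊗ F`: the completion of the algebraic tensor product
for the inner product `⟪a ⊗ b, c ⊗ d⟫ = ⟪a, c⟫ ⟪b, d⟫`. -/
def HTensor (E F : Type*) [NormedAddCommGroup E] [InnerProductSpace ℂ E]
    [NormedAddCommGroup F] [InnerProductSpace ℂ F] : Type _ :=
  UniformSpace.Completion (E ⊗[ℂ] F)

section

variable {E F : Type*} [NormedAddCommGroup E] [InnerProductSpace ℂ E]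
  [NormedAddCommGroup F] [InnerProductSpace ℂ F]

instance instGroupHTensor : NormedAddCommGroup (HTensor E F) :=
  inferInstanceAs (NormedAddCommGroup (UniformSpace.Completion (E ⊗[ℂ] F)))

instance instInnerHTensor : InnerProductSpace ℂ (HTensor E F) :=
  inferInstanceAs (InnerProductSpace ℂ (UniformSpace.Completion (E ⊗[ℂ] F)))

instance instCompleteHTensor : CompleteSpace (HTensor E F) :=
  inferInstanceAs (CompleteSpace (UniformSpace.Completion (E ⊗[ℂ] F)))

/-- The canonical isometric embedding of the algebraic tensor product with dense range. -/
def toHTensor : E ⊗[ℂ] F →ₗᵢ[ℂ] HTensor E F :=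
  (UniformSpace.Completion.toComplₗᵢ : E ⊗[ℂ] F →ₗᵢ[ℂ] UniformSpace.Completion (E ⊗[ℂ] F))

theorem denseRange_toHTensor : DenseRange (toHTensor : E ⊗[ℂ] F → HTensor E F) :=
  UniformSpace.Completion.denseRange_coe

/-- The elementary tensor `x ⊗ y` in `E ⊗ F`. -/
def htmul (x : E) (y : F) : HTensor E F := toHTensor (x ⊗ₜ[ℂ] y)

theorem inner_htmul (x x' : E) (y y' : F) :
    inner ℂ (htmul x y) (htmul x' y') = inner ℂ x x' * inner ℂ y y' := by
  simp [htmul]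

theorem htmul_smul (c d : ℂ) (x : E) (y : F) :
    htmul (c • x) (d • y) = (c * d) • htmul x y := by
  rw [htmul, TensorProduct.smul_tmul_smul, map_smul, htmul]

/-- The ampliation `Z ⊗ I_F` on `E ⊗ F` of a bounded operator `Z` on `E`. -/
def ampl (F : Type*) [NormedAddCommGroup F] [InnerProductSpace ℂ F] (Z : E →L[ℂ] E) :
    HTensor E F →L[ℂ] HTensor E F :=
  ((Z.rTensor F).completion :
    UniformSpace.Completion (E ⊗[ℂ] F) →L[ℂ] UniformSpace.Completion (E ⊗[ℂ] F))

theorem ampl_htmul (Z : E →L[ℂ] E) (x : E) (y : F) :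
    ampl F Z (htmul x y) = htmul (Z x) y :=
  ContinuousLinearMap.completion_apply_coe (Z.rTensor F) (x ⊗ₜ[ℂ] y)

end

/-! ### Symmetric Fock space -/

/-- A bundled complex Hilbert space, used only to define tensor powers by recursion. -/
structure HilbertSpace : Type (u + 1) where
  carrier : Type u
  [group : NormedAddCommGroup carrier]
  [inner : InnerProductSpace ℂ carrier]
  [complete : CompleteSpace carrier]

attribute [instance] HilbertSpace.group HilbertSpace.inner HilbertSpace.complete

/-- The Hilbert space `ℂ`, lifted to an arbitrary universe. -/
instance instInnerULift : InnerProductSpace ℂ (ULift ℂ) where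
  inner x y := inner ℂ x.down y.down
  norm_sq_eq_re_inner x := norm_sq_eq_re_inner (𝕜 := ℂ) x.down
  conj_inner_symm x y := inner_conj_symm x.down y.down
  add_left x y z := inner_add_left x.down y.down z.down
  smul_left x y c := inner_smul_left x.down y.down c

section Fock

variable (K : Type u) [NormedAddCommGroup K] [InnerProductSpace ℂ K]

/-- The Hilbert space tensor powers of `K`: `ℂ`, `K ⊗ ℂ`, `K ⊗ (K ⊗ ℂ)`, … -/
def tensorPow : ℕ → HilbertSpace.{u}
  | 0 => ⟨ULift ℂ⟩
  | n + 1 => ⟨HTensor K (tensorPow n).carrier⟩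

variable {K}

/-- The tensor power `f ⊗ ⋯ ⊗ f` (`n` factors). -/
def powVec (f : K) : (n : ℕ) → (tensorPow K n).carrier
  | 0 => (ULift.up 1 : ULift ℂ)
  | n + 1 => (htmul f (powVec f n) : HTensor K (tensorPow K n).carrier)

theorem inner_powVec (f g : K) (n : ℕ) :
    inner ℂ (powVec f n) (powVec g n) = inner ℂ f g ^ n := by
  induction n with
  | zero => exact (show inner ℂ (1 : ℂ) (1 : ℂ) = _ by simp)
  | succ n ih =>
    rw [pow_succ', ← ih]
    exact inner_htmul f g (powVec f n) (powVec g n)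

theorem powVec_smul (c : ℂ) (f : K) (n : ℕ) : powVec (c • f) n = c ^ n • powVec f n := by
  induction n with
  | zero => rw [pow_zero, one_smul]; rfl
  | succ n ih =>
    have : powVec (c • f) (n + 1) = htmul (c • f) (powVec (c • f) n) := rfl
    rw [this, ih, htmul_smul, ← pow_succ']
    rfl

variable (K)

/-- The `n`-th symmetric tensor power of `K`: the closed linear span of the vectors `f ⊗ ⋯ ⊗ f`
in the `n`-th Hilbert space tensor power (by polarization, these span the symmetric tensors). -/
def symPow (n : ℕ) : Submodule ℂ (tensorPow K n).carrier :=
  (Submodule.span ℂ (Set.range fun f : K => powVec f n)).topologicalClosure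

instance instCompleteSymPow (n : ℕ) : CompleteSpace (symPow K n) :=
  (Submodule.isClosed_topologicalClosure _).completeSpace_coe

/-- The symmetric Fock space over `K`: the Hilbert space direct sum of the symmetric powers. -/
def Fock : Type u := lp (fun n : ℕ => symPow K n) 2

instance instGroupFock : NormedAddCommGroup (Fock K) :=
  inferInstanceAs (NormedAddCommGroup (lp (fun n : ℕ => symPow K n) 2))

instance instInnerFock : InnerProductSpace ℂ (Fock K) :=
  inferInstanceAs (InnerProductSpace ℂ (lp (fun n : ℕ => symPow K n) 2))

instance instCompleteFock : CompleteSpace (Fock K) :=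
  inferInstanceAs (CompleteSpace (lp (fun n : ℕ => symPow K n) 2))

variable {K}

/-- The vector `f ⊗ ⋯ ⊗ f` (`n` factors) as an element of the symmetric power. -/
def symVec (f : K) (n : ℕ) : symPow K n :=
  ⟨powVec f n, Submodule.le_topologicalClosure _ (Submodule.subset_span ⟨f, rfl⟩)⟩

theorem inner_symVec (f g : K) (n : ℕ) :
    inner ℂ (symVec f n) (symVec g n) = inner ℂ f g ^ n :=
  inner_powVec f g n

theorem symVec_smul (c : ℂ) (f : K) (n : ℕ) : symVec (c • f) n = c ^ n • symVec f n :=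
  Subtype.ext (powVec_smul c f n)

theorem eq_zero_of_inner_symVec {n : ℕ} (v : symPow K n)
    (h : ∀ f : K, inner ℂ (symVec f n) v = 0) : v = 0 := by
  have h2 : symPow K n ≤ (ℂ ∙ (v : (tensorPow K n).carrier))ᗮ := by
    refine Submodule.topologicalClosure_minimal _ ?_ (Submodule.isClosed_orthogonal _)
    rw [Submodule.span_le]
    rintro _ ⟨f, rfl⟩
    exact Submodule.mem_orthogonal_singleton_iff_inner_left.2 (h f)
  have h3 := Submodule.mem_orthogonal_singleton_iff_inner_left.1 (h2 v.2)
  exact Subtype.ext (inner_self_eq_zero.1 h3)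

/-- The `n`-particle component `(n!)^{-1/2} f ⊗ ⋯ ⊗ f` of the exponential vector of `f`. -/
def expComponent (f : K) (n : ℕ) : symPow K n :=
  ((Real.sqrt n.factorial : ℝ) : ℂ)⁻¹ • symVec f n

theorem inner_expComponent (f g : K) (n : ℕ) :
    inner ℂ (expComponent f n) (expComponent g n) = inner ℂ f g ^ n / n.factorial := by
  have h : ((Real.sqrt n.factorial : ℝ) : ℂ) * ((Real.sqrt n.factorial : ℝ) : ℂ)
      = n.factorial := by
    rw [← Complex.ofReal_mul, Real.mul_self_sqrt (by positivity)]; simp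
  rw [expComponent, expComponent, inner_smul_left, inner_smul_right, inner_symVec, map_inv₀,
    Complex.conj_ofReal, ← mul_assoc, ← mul_inv, h, div_eq_inv_mul]

theorem memℓp_expComponent (f : K) : Memℓp (expComponent f) 2 := by
  rw [memℓp_gen_iff (by simp)]
  have : ∀ n, ‖expComponent f n‖ ^ (2 : ℝ≥0∞).toReal = (‖f‖ ^ 2) ^ n / n.factorial := by
    intro n
    have h1 : ((‖expComponent f n‖ ^ 2 : ℝ) : ℂ) = (((‖f‖ ^ 2) ^ n / n.factorial : ℝ) : ℂ) := by
      have h := inner_expComponent f f n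
      rw [inner_self_eq_norm_sq_to_K (𝕜 := ℂ) f] at h
      have h' := inner_self_eq_norm_sq_to_K (𝕜 := ℂ) (expComponent f n)
      rw [h'] at h
      push_cast
      exact h
    simpa using Complex.ofReal_injective h1
  rw [funext this]
  exact Real.summable_pow_div_factorial _

/-- The exponential vector `(1, f, (2!)^{-1/2} f ⊗ f, …)` of `f`. -/
def expVec (f : K) : Fock K :=
  (⟨expComponent f, memℓp_expComponent f⟩ : lp (fun n : ℕ => symPow K n) 2)

theorem inner_expVec (f g : K) :
    inner ℂ (expVec f) (expVec g) = Complex.exp (inner ℂ f g) := by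
  have h := lp.hasSum_inner (𝕜 := ℂ) (G := fun n : ℕ => symPow K n) (expVec f) (expVec g)
  have h2 : HasSum (fun n : ℕ => inner ℂ f g ^ n / (n.factorial : ℂ))
      (Complex.exp (inner ℂ f g)) := by
    rw [Complex.exp_eq_exp_ℂ]
    exact NormedSpace.expSeries_div_hasSum_exp _
  rw [← funext fun n => inner_expComponent f g n] at h2
  exact h.unique h2

theorem dense_span_expVec :
    Dense (Submodule.span ℂ (Set.range (expVec : K → Fock K)) : Set (Fock K)) := by
  rw [Submodule.dense_iff_topologicalClosure_eq_top, Submodule.topologicalClosure_eq_top_iff,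
    Submodule.eq_bot_iff]
  intro v hv
  have hv' : ∀ f : K, inner ℂ (expVec f) v = 0 := fun f =>
    (Submodule.mem_orthogonal _ _).1 hv _ (Submodule.subset_span ⟨f, rfl⟩)
  let w : lp (fun n : ℕ => symPow K n) 2 := v
  suffices hw : ∀ n, w n = 0 from lp.ext (funext hw)
  intro n
  refine eq_zero_of_inner_symVec _ fun f => ?_
  let p : FormalMultilinearSeries ℂ ℂ ℂ := fun n =>
    ContinuousMultilinearMap.mkPiRing ℂ (Fin n) (inner ℂ (expComponent f n) (w n))
  have hp : HasFPowerSeriesAt (0 : ℂ → ℂ) p 0 := by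
    rw [hasFPowerSeriesAt_iff]
    refine Eventually.of_forall fun z => ?_
    have h := lp.hasSum_inner (𝕜 := ℂ) (G := fun n : ℕ => symPow K n)
      (expVec ((starRingEnd ℂ z) • f)) w
    have h0 := hv' ((starRingEnd ℂ z) • f)
    rw [show inner ℂ _ w = (0 : ℂ) from h0] at h
    have h3 : ∀ m, z ^ m • p.coeff m = inner ℂ (expComponent ((starRingEnd ℂ z) • f) m) (w m) := by
      intro m
      rw [expComponent, symVec_smul, smul_comm, ← expComponent, inner_smul_left]
      simp [p, FormalMultilinearSeries.coeff]
    rw [funext h3]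
    exact h
  have h4 := hp.eq_zero
  have h5 : inner ℂ (expComponent f n) (w n) = 0 := by
    have := congrArg (fun q => FormalMultilinearSeries.coeff q n) h4
    simpa [p, FormalMultilinearSeries.coeff] using this
  rw [expComponent, inner_smul_left, mul_eq_zero] at h5
  refine h5.resolve_left ?_
  simp [Nat.factorial_ne_zero]

end Fock

section

variable {E F : Type*} [NormedAddCommGroup E] [InnerProductSpace ℂ E]
  [NormedAddCommGroup F] [InnerProductSpace ℂ F]

theorem dense_span_htmul {A : Set E} {B : Set F}
    (hA : Dense (Submodule.span ℂ A : Set E)) (hB : Dense (Submodule.span ℂ B : Set F)) :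
    Dense (Submodule.span ℂ (Set.image2 htmul A B) : Set (HTensor E F)) := by
  rw [Submodule.dense_iff_topologicalClosure_eq_top] at hA hB ⊢
  set T := (Submodule.span ℂ (Set.image2 htmul A B)).topologicalClosure with hT
  have hTc : IsClosed (T : Set (HTensor E F)) := Submodule.isClosed_topologicalClosure _
  let Lx : E → F →L[ℂ] HTensor E F := fun x =>
    toHTensor.toContinuousLinearMap.comp (TensorProduct.mkL ℂ E F x)
  let Ly : F → E →L[ℂ] HTensor E F := fun y =>
    toHTensor.toContinuousLinearMap.comp ((TensorProduct.mkL ℂ E F).flip y)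
  have h1 : ∀ b ∈ B, ∀ x : E, htmul x b ∈ T := by
    intro b hb x
    have : (Submodule.span ℂ A).topologicalClosure ≤ T.comap (Ly b).toLinearMap := by
      refine Submodule.topologicalClosure_minimal _ ?_ (hTc.preimage (Ly b).continuous)
      rw [Submodule.span_le]
      intro a ha
      exact Submodule.le_topologicalClosure _ (Submodule.subset_span ⟨a, ha, b, hb, rfl⟩)
    exact this (hA ▸ Submodule.mem_top)
  have h2 : ∀ (x : E) (y : F), htmul x y ∈ T := by
    intro x y
    have : (Submodule.span ℂ B).topologicalClosure ≤ T.comap (Lx x).toLinearMap := by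
      refine Submodule.topologicalClosure_minimal _ ?_ (hTc.preimage (Lx x).continuous)
      rw [Submodule.span_le]
      intro b hb
      exact h1 b hb x
    exact this (hB ▸ Submodule.mem_top)
  rw [eq_top_iff]
  rintro w -
  refine denseRange_toHTensor.induction_on w hTc fun z => ?_
  induction z using TensorProduct.induction_on with
  | zero => rw [map_zero]; exact T.zero_mem
  | tmul x y => exact h2 x y
  | add x y hx hy => rw [map_add]; exact T.add_mem hx hy

theorem norm_linearCombination_eq {ι : Type*} (a : ι → E) (b : ι → F)
    (hab : ∀ i j, inner ℂ (a i) (a j) = inner ℂ (b i) (b j)) (c : ι →₀ ℂ) :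
    ‖Finsupp.linearCombination ℂ b c‖ = ‖Finsupp.linearCombination ℂ a c‖ := by
  have : inner ℂ (Finsupp.linearCombination ℂ b c) (Finsupp.linearCombination ℂ b c)
      = inner ℂ (Finsupp.linearCombination ℂ a c) (Finsupp.linearCombination ℂ a c) := by
    simp only [Finsupp.linearCombination_apply, Finsupp.sum, sum_inner, inner_sum,
      inner_smul_left, inner_smul_right, hab]
  rw [norm_eq_sqrt_re_inner (𝕜 := ℂ), this, ← norm_eq_sqrt_re_inner]

variable [CompleteSpace E] [CompleteSpace F]

/-- The unitary operator sending `a i` to `b i`, for total families with equal Gram matrices. -/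
def unitaryOfTotal {ι : Type*} (a : ι → E) (b : ι → F)
    (ha : Dense (Submodule.span ℂ (Set.range a) : Set E))
    (hb : Dense (Submodule.span ℂ (Set.range b) : Set F))
    (hab : ∀ i j, inner ℂ (a i) (a j) = inner ℂ (b i) (b j)) : E ≃ₗᵢ[ℂ] F :=
  LinearEquiv.extendOfIsometry (LinearEquiv.refl ℂ (ι →₀ ℂ))
    (Finsupp.linearCombination ℂ a) (Finsupp.linearCombination ℂ b)
    (by rwa [DenseRange, ← LinearMap.coe_range, Finsupp.range_linearCombination])
    (by rwa [DenseRange, ← LinearMap.coe_range, Finsupp.range_linearCombination])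
    (norm_linearCombination_eq a b hab)

theorem unitaryOfTotal_apply {ι : Type*} (a : ι → E) (b : ι → F)
    (ha : Dense (Submodule.span ℂ (Set.range a) : Set E))
    (hb : Dense (Submodule.span ℂ (Set.range b) : Set F))
    (hab : ∀ i j, inner ℂ (a i) (a j) = inner ℂ (b i) (b j)) (i : ι) :
    unitaryOfTotal a b ha hb hab (a i) = b i := by
  have := LinearEquiv.extendOfIsometry_eq (LinearEquiv.refl ℂ (ι →₀ ℂ))
    (Finsupp.linearCombination ℂ a) (Finsupp.linearCombination ℂ b)
    (by rwa [DenseRange, ← LinearMap.coe_range, Finsupp.range_linearCombination])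
    (by rwa [DenseRange, ← LinearMap.coe_range, Finsupp.range_linearCombination])
    (norm_linearCombination_eq a b hab) (Finsupp.single i 1)
  simpa [unitaryOfTotal] using this

end

/-! ### The factorisation of Fock space -/

section Split

variable (H : Type*) [NormedAddCommGroup H] [InnerProductSpace ℂ H]
  {K K₁ K₂ : Type*} [NormedAddCommGroup K] [InnerProductSpace ℂ K]
  [NormedAddCommGroup K₁] [InnerProductSpace ℂ K₁]
  [NormedAddCommGroup K₂] [InnerProductSpace ℂ K₂]

theorem dense_span_htmul_expVec :
    Dense (Submodule.span ℂ (Set.range fun p : H × K => htmul p.1 (expVec p.2)) :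
      Set (HTensor H (Fock K))) := by
  have h := dense_span_htmul (A := (Set.univ : Set H)) (B := Set.range (expVec : K → Fock K))
    (by simp) dense_span_expVec
  refine h.mono (Submodule.span_mono ?_)
  rintro _ ⟨u, -, _, ⟨f, rfl⟩, rfl⟩
  exact ⟨(u, f), rfl⟩

variable (a : K₁ →ₗᵢ[ℂ] K) (b : K₂ →ₗᵢ[ℂ] K)
  (hab : ∀ f g, inner ℂ (a f) (b g) = 0) (hsum : ∀ f, ∃ f₁ f₂, a f₁ + b f₂ = f)

/-- If `K` is the orthogonal direct sum of the ranges of two isometries `a` and `b`, this is the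
unitary isomorphism `(H ⊗ Γ(K₁)) ⊗ Γ(K₂) ≅ H ⊗ Γ(K)` between tensor products with symmetric Fock
spaces that maps `(u ⊗ ε(f)) ⊗ ε(g)` to `u ⊗ ε(a f + b g)`. -/
def fockSplit : HTensor (HTensor H (Fock K₁)) (Fock K₂) ≃ₗᵢ[ℂ] HTensor H (Fock K) :=
  unitaryOfTotal
    (fun p : H × K₁ × K₂ => htmul (htmul p.1 (expVec p.2.1)) (expVec p.2.2))
    (fun p : H × K₁ × K₂ => htmul p.1 (expVec (a p.2.1 + b p.2.2)))
    (by
      refine (dense_span_htmul (dense_span_htmul_expVec H (K := K₁))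
        (dense_span_expVec (K := K₂))).mono (Submodule.span_mono ?_)
      rintro _ ⟨_, ⟨⟨u, f⟩, rfl⟩, _, ⟨g, rfl⟩, rfl⟩
      exact ⟨(u, f, g), rfl⟩)
    (by
      refine (dense_span_htmul_expVec H (K := K)).mono (Submodule.span_mono ?_)
      rintro _ ⟨⟨u, f⟩, rfl⟩
      obtain ⟨f₁, f₂, rfl⟩ := hsum f
      exact ⟨(u, f₁, f₂), rfl⟩)
    (by
      rintro ⟨u, f, g⟩ ⟨u', f', g'⟩
      have hba : inner ℂ (b g) (a f') = 0 := by rw [← inner_conj_symm, hab, map_zero]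
      simp only [inner_htmul, inner_expVec, inner_add_left, inner_add_right, hab, hba,
        LinearIsometry.inner_map_map, add_zero, zero_add, Complex.exp_add, mul_assoc])

theorem fockSplit_htmul (u : H) (f : K₁) (g : K₂) :
    fockSplit H a b hab hsum (htmul (htmul u (expVec f)) (expVec g))
      = htmul u (expVec (a f + b g)) :=
  unitaryOfTotal_apply _ _ _ _ _ (u, f, g)

end Split

/-! ### The noise space, time shifts and cocycles -/

section L2

variable (k : Type*) [NormedAddCommGroup k]

/-- The space `L²(I; k)`, for `I ⊆ ℝ` with Lebesgue measure. -/
abbrev L2On (I : Set ℝ) : Type _ := Lp k 2 (volume.restrict I)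

variable {k}

theorem memLp_indicator {I J : Set ℝ} (hIJ : I ⊆ J) (hI : MeasurableSet I) (f : L2On k I) :
    MemLp (I.indicator f) 2 (volume.restrict J) := by
  rw [memLp_indicator_iff_restrict hI, Measure.restrict_restrict_of_subset hIJ]
  exact Lp.memLp f

theorem ae_imp_of_subset {I J : Set ℝ} (hIJ : I ⊆ J) (hI : MeasurableSet I) {p : ℝ → Prop}
    (h : ∀ᵐ u ∂volume.restrict I, p u) : ∀ᵐ u ∂volume.restrict J, u ∈ I → p u := by
  rwa [← ae_restrict_iff' hI, Measure.restrict_restrict_of_subset hIJ]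

variable [InnerProductSpace ℂ k]

/-- Extension by zero `L²(I; k) → L²(J; k)`, for `I ⊆ J`. -/
def extZero {I J : Set ℝ} (hIJ : I ⊆ J) (hI : MeasurableSet I) : L2On k I →ₗᵢ[ℂ] L2On k J where
  toFun f := (memLp_indicator hIJ hI f).toLp (I.indicator f)
  map_add' f g := by
    rw [← MemLp.toLp_add, MemLp.toLp_eq_toLp_iff]
    filter_upwards [ae_imp_of_subset hIJ hI (Lp.coeFn_add f g)] with u hu
    by_cases h : u ∈ I
    · rw [Pi.add_apply, Set.indicator_of_mem h, Set.indicator_of_mem h, Set.indicator_of_mem h]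
      exact hu h
    · simp [h]
  map_smul' c f := by
    rw [← MemLp.toLp_const_smul, MemLp.toLp_eq_toLp_iff]
    filter_upwards [ae_imp_of_subset hIJ hI (Lp.coeFn_smul c f)] with u hu
    by_cases h : u ∈ I
    · rw [Pi.smul_apply, Set.indicator_of_mem h, Set.indicator_of_mem h]
      exact hu h
    · simp [h]
  norm_map' f := by
    change ‖(memLp_indicator hIJ hI f).toLp (I.indicator f)‖ = ‖f‖
    rw [Lp.norm_toLp, eLpNorm_indicator_eq_eLpNorm_restrict hI,
      Measure.restrict_restrict_of_subset hIJ, Lp.norm_def]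

theorem coeFn_extZero {I J : Set ℝ} (hIJ : I ⊆ J) (hI : MeasurableSet I) (f : L2On k I) :
    extZero hIJ hI f =ᵐ[volume.restrict J] I.indicator f :=
  MemLp.coeFn_toLp (memLp_indicator hIJ hI f)

theorem inner_extZero {I₁ I₂ J : Set ℝ} (h₁ : I₁ ⊆ J) (h₂ : I₂ ⊆ J) (hI₁ : MeasurableSet I₁)
    (hI₂ : MeasurableSet I₂) (hd : Disjoint I₁ I₂) (f : L2On k I₁) (g : L2On k I₂) :
    inner ℂ (extZero h₁ hI₁ f) (extZero h₂ hI₂ g) = 0 := by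
  rw [L2.inner_def]
  refine integral_eq_zero_of_ae ?_
  filter_upwards [coeFn_extZero h₁ hI₁ f, coeFn_extZero h₂ hI₂ g] with u hf hg
  rw [hf, hg]
  by_cases hu : u ∈ I₁
  · simp [Set.indicator_of_notMem (Set.disjoint_left.1 hd hu)]
  · simp [hu]

theorem exists_extZero_add {I₁ I₂ J : Set ℝ} (h₁ : I₁ ⊆ J) (h₂ : I₂ ⊆ J)
    (hI₁ : MeasurableSet I₁) (hI₂ : MeasurableSet I₂) (hd : Disjoint I₁ I₂) (hu : J ⊆ I₁ ∪ I₂)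
    (hJ : MeasurableSet J) (f : L2On k J) :
    ∃ (f₁ : L2On k I₁) (f₂ : L2On k I₂), extZero h₁ hI₁ f₁ + extZero h₂ hI₂ f₂ = f := by
  have m₁ : MemLp f 2 (volume.restrict I₁) :=
    (Lp.memLp f).mono_measure (Measure.restrict_mono_set _ h₁)
  have m₂ : MemLp f 2 (volume.restrict I₂) :=
    (Lp.memLp f).mono_measure (Measure.restrict_mono_set _ h₂)
  refine ⟨m₁.toLp f, m₂.toLp f, ?_⟩
  have e₁ := ae_imp_of_subset h₁ hI₁ m₁.coeFn_toLp
  have e₂ := ae_imp_of_subset h₂ hI₂ m₂.coeFn_toLp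
  refine Lp.ext ?_
  filter_upwards [coeFn_extZero h₁ hI₁ (m₁.toLp f), coeFn_extZero h₂ hI₂ (m₂.toLp f), e₁, e₂,
    Lp.coeFn_add (extZero h₁ hI₁ (m₁.toLp f)) (extZero h₂ hI₂ (m₂.toLp f)),
    ae_restrict_mem hJ] with u a₁ a₂ b₁ b₂ hadd huJ
  rw [hadd, Pi.add_apply, a₁, a₂]
  rcases hu huJ with h | h
  · rw [Set.indicator_of_mem h, Set.indicator_of_notMem (Set.disjoint_left.1 hd h), b₁ h, add_zero]
  · rw [Set.indicator_of_mem h, Set.indicator_of_notMem (Set.disjoint_right.1 hd h), b₂ h, zero_add]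

theorem measurePreserving_sub (t : ℝ) : MeasurePreserving (fun u : ℝ => u - t)
    (volume.restrict (Set.Ici t)) (volume.restrict (Set.Ici 0)) := by
  have h := (measurePreserving_sub_right (volume : Measure ℝ) t).restrict_preimage
    (measurableSet_Ici (a := (0 : ℝ)))
  have : (fun u : ℝ => u - t) ⁻¹' Set.Ici 0 = Set.Ici t := by ext; simp
  rwa [this] at h

theorem measurePreserving_add (t : ℝ) : MeasurePreserving (fun u : ℝ => u + t)
    (volume.restrict (Set.Ici 0)) (volume.restrict (Set.Ici t)) := by
  have h := (measurePreserving_add_right (volume : Measure ℝ) t).restrict_preimage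
    (measurableSet_Ici (a := t))
  have : (fun u : ℝ => u + t) ⁻¹' Set.Ici t = Set.Ici 0 := by ext; simp
  rwa [this] at h

theorem Ici_subset (t : ℝ≥0) : Set.Ici (t : ℝ) ⊆ Set.Ici 0 := Set.Ici_subset_Ici.2 t.2

theorem Ico_subset (t : ℝ≥0) : Set.Ico 0 (t : ℝ) ⊆ Set.Ici 0 := Set.Ico_subset_Ici_self

theorem disjoint_Ici_Ico (t : ℝ≥0) : Disjoint (Set.Ici (t : ℝ)) (Set.Ico 0 (t : ℝ)) :=
  Set.disjoint_left.2 fun _ h h' => not_lt.2 h h'.2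

theorem subset_Ici_union_Ico (t : ℝ≥0) :
    Set.Ici 0 ⊆ Set.Ici (t : ℝ) ∪ Set.Ico 0 (t : ℝ) :=
  fun u hu => (le_or_gt (t : ℝ) u).imp id fun h => ⟨hu, h⟩

variable (k)

/-- The right shift `s_t` on `L²(ℝ₊; k)`: `(s_t f)(u) = f(u - t)` for `u ≥ t`, and `0` for
`u < t`. -/
def shift (t : ℝ≥0) : L2On k (Set.Ici 0) →ₗᵢ[ℂ] L2On k (Set.Ici 0) :=
  (extZero (Ici_subset t) measurableSet_Ici).comp
    (Lp.compMeasurePreservingₗᵢ ℂ (fun u : ℝ => u - t) (measurePreserving_sub t))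

/-- The embedding `L²([0, t[; k) → L²(ℝ₊; k)` that extends functions by zero. -/
def embPast (t : ℝ≥0) : L2On k (Set.Ico 0 (t : ℝ)) →ₗᵢ[ℂ] L2On k (Set.Ici 0) :=
  extZero (Ico_subset t) measurableSet_Ico

/-- The embedding `L²([t, ∞[; k) → L²(ℝ₊; k)` that extends functions by zero. -/
def embFuture (t : ℝ≥0) : L2On k (Set.Ici (t : ℝ)) →ₗᵢ[ℂ] L2On k (Set.Ici 0) :=
  extZero (Ici_subset t) measurableSet_Ici

variable {k}

theorem coeFn_shift (t : ℝ≥0) (f : L2On k (Set.Ici 0)) :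
    shift k t f =ᵐ[volume.restrict (Set.Ici 0)]
      fun u => if u < t then 0 else f (u - t) := by
  have h1 := coeFn_extZero (Ici_subset t) measurableSet_Ici
    (Lp.compMeasurePreserving (fun u : ℝ => u - t) (measurePreserving_sub t) f)
  have h2 := ae_imp_of_subset (Ici_subset t) measurableSet_Ici
    (Lp.coeFn_compMeasurePreserving f (measurePreserving_sub t))
  filter_upwards [h1, h2] with u h1 h2
  refine h1.trans ?_
  by_cases h : (t : ℝ) ≤ u
  · rw [Set.indicator_of_mem (Set.mem_Ici.2 h), h2 h, if_neg (not_lt.2 h)]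
    rfl
  · rw [Set.indicator_of_notMem (mt Set.mem_Ici.1 h), if_pos (not_le.1 h)]

theorem inner_embPast_embFuture (t : ℝ≥0) (f : L2On k (Set.Ico 0 (t : ℝ)))
    (g : L2On k (Set.Ici (t : ℝ))) : inner ℂ (embPast k t f) (embFuture k t g) = 0 :=
  inner_extZero _ _ _ _ (disjoint_Ici_Ico t).symm _ _

theorem exists_embPast_add_embFuture (t : ℝ≥0) (f : L2On k (Set.Ici 0)) :
    ∃ f₁ f₂, embPast k t f₁ + embFuture k t f₂ = f :=
  exists_extZero_add _ _ _ _ (disjoint_Ici_Ico t).symm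
    (by rw [Set.union_comm]; exact subset_Ici_union_Ico t) measurableSet_Ici f

theorem inner_shift_embPast (t : ℝ≥0) (f : L2On k (Set.Ici 0))
    (g : L2On k (Set.Ico 0 (t : ℝ))) : inner ℂ (shift k t f) (embPast k t g) = 0 :=
  inner_extZero (Ici_subset t) (Ico_subset t) measurableSet_Ici measurableSet_Ico
    (disjoint_Ici_Ico t) _ _

theorem exists_shift_add_embPast (t : ℝ≥0) (f : L2On k (Set.Ici 0)) :
    ∃ f₁ f₂, shift k t f₁ + embPast k t f₂ = f := by
  obtain ⟨f₁, f₂, h⟩ := exists_extZero_add (Ici_subset t) (Ico_subset t) measurableSet_Ici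
    measurableSet_Ico (disjoint_Ici_Ico t) (subset_Ici_union_Ico t) measurableSet_Ici f
  let g := Lp.compMeasurePreserving (fun u : ℝ => u + t) (measurePreserving_add t) f₁
  have hg : Lp.compMeasurePreserving (fun u : ℝ => u - t) (measurePreserving_sub t) g = f₁ := by
    have h3 := Lp.compMeasurePreserving_comp_apply f₁ (measurePreserving_add t)
      (measurePreserving_sub t)
    rw [← h3]
    have h4 : (fun u : ℝ => u + t) ∘ (fun u : ℝ => u - t) = id := by ext u; simp
    simp only [h4]
    exact Lp.compMeasurePreserving_id_apply f₁
  refine ⟨g, f₂, ?_⟩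
  rw [← h]
  refine congrArg₂ (· + ·) ?_ rfl
  exact congrArg (extZero (Ici_subset t) measurableSet_Ici) hg

end L2

section Cocycle

variable (h k : Type*) [NormedAddCommGroup h] [InnerProductSpace ℂ h]
  [NormedAddCommGroup k] [InnerProductSpace ℂ k]

/-- The Hilbert space `h ⊗ F₊`, where `F₊` is the symmetric Fock space over `L²(ℝ₊; k)`. -/
abbrev FockPlus : Type _ := HTensor h (Fock (L2On k (Set.Ici 0)))

/-- The factorisation `(h ⊗ F_{[0,t[}) ⊗ F_{[t,∞[} ≅ h ⊗ F₊` of the continuous tensor product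
structure of Fock space: `(u ⊗ ε(f|_{[0,t[})) ⊗ ε(f|_{[t,∞[}) ↦ u ⊗ ε(f)`. -/
def factorAt (t : ℝ≥0) :
    HTensor (HTensor h (Fock (L2On k (Set.Ico 0 (t : ℝ))))) (Fock (L2On k (Set.Ici (t : ℝ))))
      ≃ₗᵢ[ℂ] FockPlus h k :=
  fockSplit h (embPast k t) (embFuture k t) (inner_embPast_embFuture t)
    (exists_embPast_add_embFuture t)

/-- The identification `(h ⊗ F₊) ⊗ F_{[0,t[} ≅ (h ⊗ F_{[t,∞[}) ⊗ F_{[0,t[} ≅ h ⊗ F₊` induced by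
the shift: `(u ⊗ ε(f)) ⊗ ε(g) ↦ u ⊗ ε(s_t f + g)`. -/
def shiftFactor (t : ℝ≥0) :
    HTensor (FockPlus h k) (Fock (L2On k (Set.Ico 0 (t : ℝ)))) ≃ₗᵢ[ℂ] FockPlus h k :=
  fockSplit h (shift k t) (embPast k t) (inner_shift_embPast t) (exists_shift_add_embPast t)

variable {h k}

/-- The endomorphism semigroup `σ_t` on `B(h ⊗ F₊)` (the ampliated CCR flow): the shifted copy of
`Z` acts on `h ⊗ F_{[t,∞[}`, and the identity acts on `F_{[0,t[}`. -/
def sigma (t : ℝ≥0) (Z : FockPlus h k →L[ℂ] FockPlus h k) : FockPlus h k →L[ℂ] FockPlus h k :=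
  (shiftFactor h k t).toContinuousLinearEquiv.toContinuousLinearMap ∘L
    ampl (Fock (L2On k (Set.Ico 0 (t : ℝ)))) Z ∘L
    (shiftFactor h k t).symm.toContinuousLinearEquiv.toContinuousLinearMap

/-- Adaptedness at time `t`: `Z ∈ B(h ⊗ F_{[0,t[}) ⊗ I_{F_{[t,∞[}}`. -/
def IsAdaptedAt (t : ℝ≥0) (Z : FockPlus h k →L[ℂ] FockPlus h k) : Prop :=
  ∃ W : HTensor h (Fock (L2On k (Set.Ico 0 (t : ℝ)))) →L[ℂ]
      HTensor h (Fock (L2On k (Set.Ico 0 (t : ℝ)))),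
    Z = (factorAt h k t).toContinuousLinearEquiv.toContinuousLinearMap ∘L
      ampl (Fock (L2On k (Set.Ici (t : ℝ)))) W ∘L
      (factorAt h k t).symm.toContinuousLinearEquiv.toContinuousLinearMap

/-- A (Fock-adapted, bounded) left cocycle on `h ⊗ F₊`. -/
structure IsLeftCocycle (X : ℝ≥0 → (FockPlus h k →L[ℂ] FockPlus h k)) : Prop where
  zero : X 0 = 1
  add : ∀ r t, X (r + t) = X r * sigma r (X t)
  adapted : ∀ t, IsAdaptedAt t (X t)

/-- Convergence `X_t → I` in the weak operator topology as `t → 0`. -/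
def TendstoWeaklyId (X : ℝ≥0 → (FockPlus h k →L[ℂ] FockPlus h k)) : Prop :=
  ∀ ξ η : FockPlus h k,
    Tendsto (fun t : ℝ≥0 => inner ℂ ξ (X t η)) (𝓝[>] 0) (𝓝 (inner ℂ ξ η))

end Cocycle

end QSC
end

/-!
Let `S_t` be the second quantisation of the right shift, `S_t (u ⊗ ε(f)) = u ⊗ ε(s_t f)`
(`shiftOp`). Since `σ_t(Z) S_t = S_t Z`, the cocycle identity turns into the semigroup law for
`P_t = X_t S_t`.

*Growth.* As `‖σ_r(Z)‖ ≤ ‖Z‖`, the function `t ↦ ‖X_t‖` is submultiplicative. It is bounded near `0`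
by the uniform boundedness principle (`exists_norm_le_of_tendsto_inner`), hence exponentially bounded
(`exists_le_mul_exp`).

*Strong continuity at `0`.* Because `S_t → I` strongly and `X_t` is bounded near `0`, the semigroup
`P_t` converges weakly to `I`. A weakly continuous semigroup on a Hilbert space is strongly
continuous (`tendsto_apply_of_semigroup_of_tendsto_inner`), so `X_t S_t ξ → ξ`, and therefore
`X_t ξ → ξ` (`IsLeftCocycle.tendsto_zero`).

*Strong continuity at `t`.* The increment `X_{r+s} - X_r = X_r (σ_r(X_s) - I)` satisfies, on
`u ⊗ ε(f)`, the estimate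
`‖(X_{r+s} - X_r) (u ⊗ ε(f))‖ ≤ ‖X_r‖ ‖(X_s - I) (u ⊗ ε(s_r^* f))‖ ‖ε(f)‖`.
The adjoint shifts are strongly continuous, as compressions of the translations of `L²(ℝ; k)`, so
continuity at `0` gives continuity from both sides at `t` on these vectors, which are total.
-/

namespace QSC

attribute [-instance] CStarModule.toInner

/-! ### Operator families on a Hilbert space -/

section Semigroup

variable {H : Type*} [NormedAddCommGroup H] [InnerProductSpace ℂ H]

/-- For eventually bounded families of operators, strong convergence needs only be checked on a
total set of vectors. -/
theorem tendsto_apply_of_dense_span {ι : Type*} {l : Filter ι} {A : ι → H →L[ℂ] H}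
    {B : H →L[ℂ] H} {D : Set H} (hD : Dense (Submodule.span ℂ D : Set H)) {M : ℝ}
    (hA : ∀ᶠ i in l, ‖A i‖ ≤ M) (h : ∀ x ∈ D, Tendsto (fun i => A i x) l (𝓝 (B x))) (x : H) :
    Tendsto (fun i => A i x) l (𝓝 (B x)) := by
  have hspan : ∀ y ∈ Submodule.span ℂ D, Tendsto (fun i => A i y) l (𝓝 (B y)) := by
    intro y hy
    induction hy using Submodule.span_induction with
    | mem y hy => exact h y hy
    | zero => simpa using tendsto_const_nhds
    | add y z _ _ hy hz => simpa using hy.add hz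
    | smul c y _ hy => simpa using hy.const_smul c
  rw [Metric.tendsto_nhds]
  intro ε hε
  have hM : 0 < |M| + ‖B‖ + 1 := by positivity
  obtain ⟨y, hy, hxy⟩ := Metric.dense_iff.1 hD x (ε / 2 / (|M| + ‖B‖ + 1)) (by positivity)
  rw [Metric.mem_ball, lt_div_iff₀ hM, dist_eq_norm, norm_sub_rev] at hy
  filter_upwards [hA, Metric.tendsto_nhds.1 (hspan y hxy) (ε / 2) (half_pos hε)] with i hi hyi
  have h1 : A i x - B x = A i (x - y) + (A i y - B y) + B (y - x) := by simp
  have h2 : ‖A i (x - y)‖ ≤ |M| * ‖x - y‖ :=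
    (A i).le_of_opNorm_le (hi.trans (le_abs_self M)) _
  have h3 : ‖B (y - x)‖ ≤ ‖B‖ * ‖x - y‖ := by
    rw [norm_sub_rev x]; exact B.le_opNorm _
  rw [dist_eq_norm] at hyi ⊢
  rw [h1]
  have h4 := norm_add₃_le (a := A i (x - y)) (b := A i y - B y) (c := B (y - x))
  nlinarith [norm_nonneg (x - y)]

variable [CompleteSpace H]

/-- Weak convergence along all of `𝓝[>] 0` bounds the operators near `0`: otherwise the uniform
boundedness principle would fail along some sequence of times. -/
theorem exists_norm_le_of_tendsto_inner {X : ℝ≥0 → H →L[ℂ] H}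
    (hX : ∀ ξ η : H, Tendsto (fun t => inner ℂ ξ (X t η)) (𝓝[>] 0) (𝓝 (inner ℂ ξ η))) :
    ∃ δ : ℝ≥0, 0 < δ ∧ ∃ C : ℝ, ∀ t, t < δ → ‖X t‖ ≤ C := by
  suffices h : ∃ δ : ℝ≥0, 0 < δ ∧ ∃ C : ℝ, ∀ t, 0 < t → t < δ → ‖X t‖ ≤ C by
    obtain ⟨δ, hδ, C, hC⟩ := h
    refine ⟨δ, hδ, max C ‖X 0‖, fun t ht => ?_⟩
    rcases eq_or_ne t 0 with rfl | h0
    · exact le_max_right _ _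
    · exact (hC t (pos_iff_ne_zero.2 h0) ht).trans (le_max_left _ _)
  by_contra! hcon
  have hpos : ∀ n : ℕ, (0 : ℝ≥0) < 1 / ((n : ℝ≥0) + 1) := fun n => by positivity
  choose t ht0 ht1 htX using fun n : ℕ => hcon (1 / ((n : ℝ≥0) + 1)) (hpos n) n
  have htt : Tendsto t atTop (𝓝[>] 0) := by
    refine tendsto_nhdsWithin_iff.2 ⟨?_, Eventually.of_forall ht0⟩
    exact tendsto_of_tendsto_of_tendsto_of_le_of_le tendsto_const_nhds
      tendsto_one_div_add_atTop_nhds_zero_nat (fun _ => zero_le) fun n => (ht1 n).le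
  obtain ⟨C, hC⟩ := banach_steinhaus (g := fun n => X (t n)) fun η => by
    obtain ⟨C, hC⟩ := banach_steinhaus (g := fun n => innerSL ℂ (X (t n) η)) fun ξ => by
      have h1 := ((hX ξ η).comp htt).norm.isBoundedUnder_le.bddAbove_range
      obtain ⟨C, hC⟩ := h1
      refine ⟨C, fun n => ?_⟩
      rw [innerSL_apply_apply, ← inner_conj_symm, RCLike.norm_conj]
      exact hC ⟨n, rfl⟩
    exact ⟨C, fun n => by simpa using hC n⟩
  obtain ⟨n, hn⟩ := exists_nat_gt C
  exact absurd (htX n) (not_lt.2 ((hC n).trans hn.le))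

/-- A submultiplicative function that is bounded near `0` grows at most exponentially. -/
theorem exists_le_mul_exp {p : ℝ≥0 → ℝ} (h0 : ∀ t, 0 ≤ p t)
    (hadd : ∀ r t, p (r + t) ≤ p r * p t) {δ : ℝ≥0} (hδ : 0 < δ) {C : ℝ}
    (hC : ∀ t, t < δ → p t ≤ C) : ∃ M a : ℝ, ∀ t : ℝ≥0, p t ≤ M * Real.exp (a * t) := by
  set c := max C 1 with hc
  have hc1 : 1 ≤ c := le_max_right _ _
  -- steps of length `δ / 2` stay strictly inside the interval where `C` is a bound
  have hcC : ∀ t, t ≤ δ / 2 → p t ≤ c := fun t ht =>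
    (hC t (ht.trans_lt (NNReal.half_lt_self hδ.ne'))).trans (le_max_left _ _)
  have hη : 0 < δ / 2 := half_pos hδ
  have hpow : ∀ n : ℕ, ∀ t : ℝ≥0, t ≤ (n + 1) * (δ / 2) → p t ≤ c ^ (n + 1) := by
    intro n
    induction n with
    | zero => intro t ht; simpa only [zero_add, pow_one] using hcC t (by simpa using ht)
    | succ n ih =>
      intro t ht
      rcases le_total t (δ / 2) with hle | hle
      · exact (hcC t hle).trans (le_self_pow₀ hc1 (by simp))
      · have h1 : t - δ / 2 ≤ (n + 1) * (δ / 2) := by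
          rw [tsub_le_iff_right]
          refine ht.trans_eq ?_
          push_cast
          ring
        rw [← add_tsub_cancel_of_le hle, pow_succ']
        exact (hadd _ _).trans
          (mul_le_mul (hcC _ le_rfl) (ih _ h1) (h0 _) (zero_le_one.trans hc1))
  refine ⟨c, Real.log c / (δ / 2), fun t => ?_⟩
  have h1 : t < ((⌊t / (δ / 2)⌋₊ : ℕ) + 1 : ℝ≥0) * (δ / 2) := by
    rw [← div_lt_iff₀ hη]; exact Nat.lt_floor_add_one _
  have h2 : (⌊t / (δ / 2)⌋₊ : ℝ) ≤ t / (δ / 2) := by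
    exact_mod_cast Nat.floor_le (zero_le (a := t / (δ / 2)))
  have hlog : 0 ≤ Real.log c := Real.log_nonneg hc1
  have h3 : c ^ ⌊t / (δ / 2)⌋₊ ≤ Real.exp (Real.log c / (δ / 2) * t) := by
    rw [← Real.exp_log (pow_pos (zero_lt_one.trans_le hc1) _), Real.log_pow]
    apply Real.exp_le_exp.2
    rw [div_mul_eq_mul_div, mul_div_assoc, mul_comm]
    gcongr
  refine (hpow _ t h1.le).trans ?_
  rw [pow_succ']
  gcongr

/-- A right-continuous function on the line is a pointwise limit of functions of `⌊(n + 1) x⌋`. -/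
theorem measurable_of_continuousWithinAt_Ioi {g : ℝ → ℂ}
    (hg : ∀ x, ContinuousWithinAt g (Set.Ioi x) x) : Measurable g := by
  refine measurable_of_tendsto_metrizable
    (f := fun (n : ℕ) x => g ((⌊((n : ℝ) + 1) * x⌋ + 1) / ((n : ℝ) + 1))) (fun n => ?_) ?_
  · exact (measurable_from_top (f := fun m : ℤ => g ((m + 1) / ((n : ℝ) + 1)))).comp
      (Int.measurable_floor.comp (measurable_const_mul ((n : ℝ) + 1)))
  rw [tendsto_pi_nhds]
  intro x
  refine (hg x).tendsto.comp (tendsto_nhdsWithin_iff.2 ⟨?_, Eventually.of_forall fun n => ?_⟩)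
  · have h1 : Tendsto (fun n : ℕ => x + 1 / ((n : ℝ) + 1)) atTop (𝓝 x) := by
      simpa using tendsto_const_nhds.add (tendsto_one_div_add_atTop_nhds_zero_nat (𝕜 := ℝ))
    refine tendsto_of_tendsto_of_tendsto_of_le_of_le tendsto_const_nhds h1 (fun n => ?_) fun n => ?_
    · have hn : (0 : ℝ) < (n : ℝ) + 1 := by positivity
      rw [le_div_iff₀ hn, mul_comm]
      exact (Int.lt_floor_add_one _).le
    · have hn : (0 : ℝ) < (n : ℝ) + 1 := by positivity
      have : x + 1 / ((n : ℝ) + 1) = (((n : ℝ) + 1) * x + 1) / ((n : ℝ) + 1) := by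
        field_simp
      simp only [this]
      gcongr
      exact Int.floor_le _
  · have hn : (0 : ℝ) < (n : ℝ) + 1 := by positivity
    change x < _
    rw [lt_div_iff₀ hn, mul_comm]
    exact Int.lt_floor_add_one _

/-- A weakly continuous operator semigroup on a Hilbert space is strongly continuous at `0`: the
weak integrals `y = ∫₀^τ P_s x ds` form a total set, and `‖P_t y - y‖ = O(t)`. -/
theorem tendsto_apply_of_semigroup_of_tendsto_inner {P : ℝ≥0 → H →L[ℂ] H}
    (hP : ∀ r t, P (r + t) = P r * P t) (hbd : ∀ T : ℝ≥0, ∃ M : ℝ, ∀ t ≤ T, ‖P t‖ ≤ M)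
    (hweak : ∀ ξ η : H, Tendsto (fun t => inner ℂ ξ (P t η)) (𝓝[>] 0) (𝓝 (inner ℂ ξ η)))
    (x : H) : Tendsto (fun t => P t x) (𝓝[>] 0) (𝓝 x) := by
  -- only times up to `2` occur: `τ ≤ 1` in the weak integrals, shifted by `t ≤ 1`
  obtain ⟨M, hM⟩ := hbd 2
  have hM0 : 0 ≤ M := (norm_nonneg _).trans (hM 0 zero_le)
  have hmeas : ∀ x ξ : H, Measurable fun s : ℝ => inner ℂ (P s.toNNReal x) ξ := by
    refine fun x ξ => measurable_of_continuousWithinAt_Ioi fun s => ?_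
    rcases lt_or_ge s 0 with hs | hs
    · refine ContinuousAt.continuousWithinAt ((continuousAt_const
        (y := inner ℂ (P 0 x) ξ)).congr ?_)
      filter_upwards [Iio_mem_nhds hs] with u hu
      rw [Real.toNNReal_of_nonpos (le_of_lt hu)]
    · have h1 : Tendsto (fun u : ℝ => (u - s).toNNReal) (𝓝[>] s) (𝓝[>] 0) := by
        refine tendsto_nhdsWithin_iff.2 ⟨?_, ?_⟩
        · have : Continuous fun u : ℝ => (u - s).toNNReal := by fun_prop
          simpa using (this.tendsto s).mono_left nhdsWithin_le_nhds
        · filter_upwards [self_mem_nhdsWithin] with u hu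
          exact Real.toNNReal_pos.2 (sub_pos.2 hu)
      have h2 := (hweak ((P s.toNNReal).adjoint ξ) x).comp h1
      have h3 := (Complex.continuous_conj.tendsto _).comp h2
      rw [inner_conj_symm, ContinuousLinearMap.adjoint_inner_right] at h3
      refine h3.congr' ?_
      filter_upwards [self_mem_nhdsWithin] with u hu
      have h4 : u.toNNReal = s.toNNReal + (u - s).toNNReal := by
        rw [← Real.toNNReal_add hs (sub_nonneg.2 (le_of_lt hu)), add_sub_cancel]
      simp only [Function.comp_apply]
      rw [inner_conj_symm, ContinuousLinearMap.adjoint_inner_right, h4, hP]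
      rfl
  have hle : ∀ x ξ : H, ∀ s : ℝ, s ≤ 2 → ‖inner ℂ (P s.toNNReal x) ξ‖ ≤ M * ‖x‖ * ‖ξ‖ := by
    intro x ξ s hs
    refine (norm_inner_le_norm _ _).trans ?_
    gcongr
    exact (P _).le_of_opNorm_le (hM _ (by simpa using Real.toNNReal_le_toNNReal hs)) _
  have hint : ∀ x ξ : H, ∀ a b : ℝ, a ≤ 2 → b ≤ 2 →
      IntervalIntegrable (fun s : ℝ => inner ℂ (P s.toNNReal x) ξ) volume a b := by
    intro x ξ a b ha hb
    refine (intervalIntegrable_const (c := M * ‖x‖ * ‖ξ‖)).mono_fun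
      (hmeas x ξ).aestronglyMeasurable ?_
    filter_upwards [ae_restrict_mem measurableSet_uIoc] with s hs
    refine (hle x ξ s (hs.2.trans (max_le ha hb))).trans (le_abs_self _)
  -- the Riesz representation of the integral of the functionals `⟪P_s x, ·⟫`
  have hy : ∀ (x : H) (τ : ℝ), 0 ≤ τ → τ ≤ 2 → ∃ y : H, ∀ ξ, inner ℂ y ξ = ∫ s in (0:ℝ)..τ,
      inner ℂ (P s.toNNReal x) ξ := by
    intro x τ hτ0 hτ
    let φ : H →ₗ[ℂ] ℂ :=
      { toFun ξ := ∫ s in (0:ℝ)..τ, inner ℂ (P s.toNNReal x) ξ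
        map_add' ξ η := by
          simp only [inner_add_right]
          exact intervalIntegral.integral_add (hint _ _ _ _ (by norm_num) hτ)
            (hint _ _ _ _ (by norm_num) hτ)
        map_smul' c ξ := by
          simp [inner_smul_right] }
    let Φ : H →L[ℂ] ℂ := φ.mkContinuous (M * ‖x‖ * τ) fun ξ => by
      have := intervalIntegral.norm_integral_le_of_norm_le_const (a := 0) (b := τ)
        (f := fun s : ℝ => inner ℂ (P s.toNNReal x) ξ) (C := M * ‖x‖ * ‖ξ‖) fun s hs => by
          rw [Set.uIoc_of_le hτ0] at hs
          exact hle x ξ s (hs.2.trans hτ)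
      rw [sub_zero, abs_of_nonneg hτ0] at this
      exact this.trans_eq (by ring)
    refine ⟨(InnerProductSpace.toDual ℂ H).symm Φ, fun ξ => ?_⟩
    rw [InnerProductSpace.toDual_symm_apply]
    rfl
  let D : Set H := {y | ∃ x : H, ∃ τ : ℝ, 0 ≤ τ ∧ τ ≤ 1 ∧
    ∀ ξ, inner ℂ y ξ = ∫ s in (0:ℝ)..τ, inner ℂ (P s.toNNReal x) ξ}
  refine tendsto_apply_of_dense_span (A := P) (B := 1) (D := D) ?_ (M := M) ?_ ?_ x
  · rw [Submodule.dense_iff_topologicalClosure_eq_top, Submodule.topologicalClosure_eq_top_iff,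
      Submodule.eq_bot_iff]
    intro ξ hξ
    by_contra hne
    -- `Re ⟪P_s ξ, ξ⟫` is positive for small `s > 0`, hence so is its integral
    have hlim := (Complex.continuous_re.tendsto _).comp (hweak ξ ξ)
    have hpos : (0 : ℝ) < (inner ℂ ξ ξ : ℂ).re := by
      rw [inner_self_eq_norm_sq_to_K]
      norm_cast
      exact pow_pos (norm_pos_iff.2 hne) 2
    obtain ⟨δ, hδ, hδpos⟩ := mem_nhdsGT_iff_exists_Ioo_subset.1 (hlim.eventually_const_lt hpos)
    have hδ0 : (0 : ℝ) < δ := hδ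
    have hτ0 : (0 : ℝ) < min δ 1 := lt_min hδ0 one_pos
    have hτ1 : min (δ : ℝ) 1 ≤ 1 := min_le_right _ _
    obtain ⟨y, hyξ⟩ := hy ξ (min δ 1) hτ0.le (hτ1.trans (by norm_num))
    have hyD : y ∈ D := ⟨ξ, _, hτ0.le, hτ1, hyξ⟩
    have hzero := (Submodule.mem_orthogonal _ _).1 hξ y (Submodule.subset_span hyD)
    have hi := hint ξ ξ 0 (min δ 1) (by norm_num) (hτ1.trans (by norm_num))
    have hre := Complex.reCLM.intervalIntegral_comp_comm hi
    rw [← hyξ, hzero, map_zero] at hre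
    refine (intervalIntegral.intervalIntegral_pos_of_pos_on
      (f := fun s => Complex.reCLM (inner ℂ (P s.toNNReal ξ) ξ))
      ⟨Complex.reCLM.integrable_comp hi.1, Complex.reCLM.integrable_comp hi.2⟩
      (fun s hs => ?_) hτ0).ne' hre
    have hs' : s.toNNReal ∈ Set.Ioo 0 δ :=
      ⟨Real.toNNReal_pos.2 hs.1,
        (Real.toNNReal_lt_iff_lt_coe hs.1.le).2 (hs.2.trans_le (min_le_left _ _))⟩
    have := hδpos hs'
    simp only [Set.mem_ofPred_eq, Function.comp_apply] at this
    rwa [← inner_conj_symm, Complex.conj_re] at this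
  · filter_upwards [nhdsWithin_le_nhds (Iio_mem_nhds (zero_lt_two (α := ℝ≥0)))] with t ht
    exact hM t (le_of_lt ht)
  · rintro y ⟨x, τ, hτ0, hτ, hyx⟩
    have key : ∀ t : ℝ≥0, t ≤ 1 → ‖P t y - y‖ ≤ 2 * M * ‖x‖ * t := by
      intro t ht
      have ht' : (t : ℝ) ≤ 1 := ht
      -- `P_t y` is the weak integral over `[t, τ + t]`, so that only two end pieces of length `t`
      -- survive in `P_t y - y`
      have hinner : ∀ ξ, inner ℂ (P t y - y) ξ =
          (∫ s in τ..(τ + t), inner ℂ (P s.toNNReal x) ξ) -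
            ∫ s in (0:ℝ)..t, inner ℂ (P s.toNNReal x) ξ := by
        intro ξ
        have h1 : inner ℂ (P t y) ξ = ∫ s in (t : ℝ)..(τ + t), inner ℂ (P s.toNNReal x) ξ := by
          rw [← ContinuousLinearMap.adjoint_inner_right, hyx]
          have := intervalIntegral.integral_comp_add_right (a := 0) (b := τ)
            (fun s : ℝ => inner ℂ (P s.toNNReal x) ξ) (t : ℝ)
          rw [zero_add] at this
          rw [← this]
          refine intervalIntegral.integral_congr fun s hs => ?_
          rw [Set.uIcc_of_le hτ0] at hs
          rw [ContinuousLinearMap.adjoint_inner_right, Real.toNNReal_add hs.1 t.coe_nonneg,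
            Real.toNNReal_coe, add_comm, hP]
          rfl
        rw [inner_sub_left, h1, hyx]
        have e1 := intervalIntegral.integral_add_adjacent_intervals
          (hint x ξ 0 t (by norm_num) (by linarith))
          (hint x ξ t (τ + t) (by linarith) (by linarith))
        have e2 := intervalIntegral.integral_add_adjacent_intervals
          (hint x ξ 0 τ (by norm_num) (by linarith))
          (hint x ξ τ (τ + t) (by linarith) (by linarith))
        linear_combination e1 - e2
      have hb : ∀ ξ, ‖inner ℂ (P t y - y) ξ‖ ≤ 2 * M * ‖x‖ * t * ‖ξ‖ := by
        intro ξ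
        rw [hinner]
        have b1 := intervalIntegral.norm_integral_le_of_norm_le_const (a := τ) (b := τ + t)
          (f := fun s : ℝ => inner ℂ (P s.toNNReal x) ξ) (C := M * ‖x‖ * ‖ξ‖) fun s hs => by
            rw [Set.uIoc_of_le (by simp)] at hs
            exact hle x ξ s (by linarith [hs.2])
        have b2 := intervalIntegral.norm_integral_le_of_norm_le_const (a := 0) (b := (t : ℝ))
          (f := fun s : ℝ => inner ℂ (P s.toNNReal x) ξ) (C := M * ‖x‖ * ‖ξ‖) fun s hs => by
            rw [Set.uIoc_of_le t.coe_nonneg] at hs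
            exact hle x ξ s (by linarith [hs.2])
        rw [add_sub_cancel_left, abs_of_nonneg t.coe_nonneg] at b1
        rw [sub_zero, abs_of_nonneg t.coe_nonneg] at b2
        refine (norm_sub_le _ _).trans ((add_le_add b1 b2).trans_eq (by ring))
      rcases (norm_nonneg (P t y - y)).eq_or_lt with hzero | hpos
      · rw [← hzero]
        positivity
      have := hb (P t y - y)
      rw [inner_self_eq_norm_sq_to_K, norm_pow, RCLike.norm_ofReal, abs_norm, sq] at this
      exact le_of_mul_le_mul_right this (hpos)
    rw [one_apply_eq_self, tendsto_iff_norm_sub_tendsto_zero]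
    have hlim : Tendsto (fun t : ℝ≥0 => 2 * M * ‖x‖ * t) (𝓝[>] 0) (𝓝 0) := by
      have : Continuous fun t : ℝ≥0 => 2 * M * ‖x‖ * (t : ℝ) := by fun_prop
      simpa using (this.tendsto 0).mono_left nhdsWithin_le_nhds
    refine squeeze_zero' (Eventually.of_forall fun _ => norm_nonneg _) ?_ hlim
    filter_upwards [nhdsWithin_le_nhds (Iio_mem_nhds (zero_lt_one (α := ℝ≥0)))] with t ht
    exact key t (le_of_lt ht)

end Semigroup
/-! ### Tensor products and exponential vectors -/

section Tensor

variable {E F : Type*} [NormedAddCommGroup E] [InnerProductSpace ℂ E]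
  [NormedAddCommGroup F] [InnerProductSpace ℂ F]

theorem norm_htmul (x : E) (y : F) : ‖htmul x y‖ = ‖x‖ * ‖y‖ := by
  rw [htmul, LinearIsometry.norm_map, TensorProduct.norm_tmul]

theorem htmul_sub_left (x x' : E) (y : F) : htmul (x - x') y = htmul x y - htmul x' y := by
  rw [htmul, TensorProduct.sub_tmul, map_sub, htmul, htmul]

theorem continuous_htmul_right (x : E) : Continuous fun y : F => htmul x y :=
  (toHTensor.toContinuousLinearMap.comp (TensorProduct.mkL ℂ E F x)).continuous

theorem norm_ampl_le (Z : E →L[ℂ] E) : ‖ampl F Z‖ ≤ ‖Z‖ := by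
  have h : ‖ampl F Z‖ ≤ ‖Z.rTensor F‖ := by
    refine ContinuousLinearMap.opNorm_le_bound _ (ContinuousLinearMap.opNorm_nonneg _) fun w => ?_
    refine denseRange_toHTensor.induction_on w
      (isClosed_le (by fun_prop) (by fun_prop)) fun z => ?_
    have : ampl F Z (toHTensor z) = toHTensor (Z.rTensor F z) :=
      ContinuousLinearMap.completion_apply_coe (Z.rTensor F) z
    rw [this, LinearIsometry.norm_map, LinearIsometry.norm_map]
    exact (Z.rTensor F).le_opNorm z
  exact h.trans (ContinuousLinearMap.norm_rTensor_le F Z)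

theorem norm_expVec (f : E) : ‖expVec f‖ = Real.exp (‖f‖ ^ 2 / 2) := by
  have h : ‖expVec f‖ ^ 2 = Real.exp (‖f‖ ^ 2 / 2) ^ 2 := by
    have h1 := inner_expVec f f
    rw [inner_self_eq_norm_sq_to_K, inner_self_eq_norm_sq_to_K] at h1
    have h2 : (((‖expVec f‖ ^ 2 : ℝ)) : ℂ) = ((Real.exp (‖f‖ ^ 2) : ℝ) : ℂ) := by
      push_cast
      exact h1
    rw [Complex.ofReal_injective h2, ← Real.exp_nat_mul]
    congr 1
    push_cast
    ring
  exact (pow_left_inj₀ (norm_nonneg _) (Real.exp_pos _).le two_ne_zero).1 h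

theorem continuous_expVec : Continuous (expVec : E → Fock E) := by
  refine continuous_iff_continuousAt.2 fun f => ?_
  have h : ∀ g, ‖expVec g - expVec f‖ ^ 2 =
      ‖expVec g‖ ^ 2 - 2 * (Complex.exp (inner ℂ g f)).re + ‖expVec f‖ ^ 2 := by
    intro g
    rw [norm_sub_sq (𝕜 := ℂ), inner_expVec]
    rfl
  have h2 : Tendsto (fun g => ‖expVec g - expVec f‖ ^ 2) (𝓝 f) (𝓝 0) := by
    have hc : Continuous fun g : E => ‖expVec g - expVec f‖ ^ 2 := by
      simp only [h, norm_expVec]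
      fun_prop
    simpa using hc.tendsto f
  have h3 := h2.sqrt
  simp only [Real.sqrt_sq (norm_nonneg _), Real.sqrt_zero] at h3
  exact tendsto_iff_norm_sub_tendsto_zero.2 h3

end Tensor

/-! ### Shifts on `L²` -/

section Shift

variable (k : Type*) [NormedAddCommGroup k] [InnerProductSpace ℂ k]

/-- Extension by zero `L²(ℝ₊; k) → L²(ℝ; k)`. -/
noncomputable def extLine : L2On k (Set.Ici 0) →ₗᵢ[ℂ] L2On k Set.univ :=
  extZero (Set.subset_univ _) measurableSet_Ici

theorem measurePreserving_sub_univ (t : ℝ) : MeasurePreserving (fun u : ℝ => u - t)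
    (volume.restrict Set.univ) (volume.restrict Set.univ) := by
  rw [Measure.restrict_univ]
  exact measurePreserving_sub_right volume t

/-- The translation `(T_t f)(u) = f(u - t)` on `L²(ℝ; k)`, for `t` of either sign. -/
noncomputable def translate (t : ℝ) : L2On k Set.univ →ₗᵢ[ℂ] L2On k Set.univ :=
  Lp.compMeasurePreservingₗᵢ ℂ (fun u : ℝ => u - t) (measurePreserving_sub_univ t)

variable {k}

theorem coeFn_translate (t : ℝ) (f : L2On k Set.univ) :
    translate k t f =ᵐ[volume.restrict Set.univ] fun u => f (u - t) :=
  Lp.coeFn_compMeasurePreserving f (measurePreserving_sub_univ t)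

theorem translate_add (r t : ℝ) (f : L2On k Set.univ) :
    translate k (r + t) f = translate k r (translate k t f) := by
  refine Lp.ext ?_
  filter_upwards [coeFn_translate (r + t) f, coeFn_translate r (translate k t f),
    (measurePreserving_sub_univ r).quasiMeasurePreserving.ae (coeFn_translate t f)] with u h1 h2 h3
  rw [h1, h2, h3]
  congr 1
  ring

theorem translate_zero (f : L2On k Set.univ) : translate k 0 f = f := by
  refine Lp.ext ?_
  filter_upwards [coeFn_translate 0 f] with u h1
  rw [h1, sub_zero]

theorem continuous_translate (f : L2On k Set.univ) : Continuous fun t => translate k t f := by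
  have : (volume.restrict (Set.univ : Set ℝ)).InnerRegularCompactLTTop := by
    rw [Measure.restrict_univ]; infer_instance
  let g : ℝ → C(ℝ, ℝ) := fun t => ⟨fun u => u - t, by fun_prop⟩
  have hg : Continuous g := ContinuousMap.continuous_of_continuous_uncurry _
    (by simp only [g, Function.uncurry_def, ContinuousMap.coe_mk]; fun_prop)
  exact Continuous.compMeasurePreservingLp (continuous_const (y := f)) hg
    measurePreserving_sub_univ (by simp)

theorem extLine_shift (t : ℝ≥0) (f : L2On k (Set.Ici 0)) :
    extLine k (shift k t f) = translate k t (extLine k f) := by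
  refine Lp.ext ?_
  have h1 := coeFn_extZero (Set.subset_univ _) measurableSet_Ici (shift k t f)
  have h2 := ae_imp_of_subset (Set.subset_univ _) measurableSet_Ici (coeFn_shift t f)
  have h3 := coeFn_translate t (extLine k f)
  have h4 := (measurePreserving_sub_univ t).quasiMeasurePreserving.ae
    (coeFn_extZero (Set.subset_univ _) measurableSet_Ici f)
  filter_upwards [h1, h2, h3, h4] with u h1 h2 h3 h4
  refine h1.trans (Eq.trans ?_ (h3.trans h4).symm)
  have ht := t.coe_nonneg
  rcases lt_or_ge u t with hu | hu
  · rw [Set.indicator_of_notMem (s := Set.Ici 0) (a := u - t) (by simpa using hu)]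
    by_cases hu0 : u ∈ Set.Ici (0 : ℝ)
    · rw [Set.indicator_of_mem hu0, h2 hu0, if_pos hu]
    · rw [Set.indicator_of_notMem hu0]
  · have hu0 : u ∈ Set.Ici (0 : ℝ) := ht.trans hu
    rw [Set.indicator_of_mem hu0, h2 hu0, if_neg (not_lt.2 hu),
      Set.indicator_of_mem (by simpa using hu)]

theorem shift_add (r t : ℝ≥0) (f : L2On k (Set.Ici 0)) :
    shift k (r + t) f = shift k r (shift k t f) := by
  apply (extLine k).injective
  rw [extLine_shift, extLine_shift, extLine_shift, NNReal.coe_add, translate_add]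

theorem shift_zero (f : L2On k (Set.Ici 0)) : shift k 0 f = f := by
  apply (extLine k).injective
  rw [extLine_shift, NNReal.coe_zero, translate_zero]

theorem continuous_shift (f : L2On k (Set.Ici 0)) : Continuous fun t => shift k t f := by
  rw [(extLine k).isometry.isEmbedding.continuous_iff]
  have : extLine k ∘ (fun t => shift k t f) = fun t : ℝ≥0 => translate k t (extLine k f) :=
    funext fun t => extLine_shift t f
  rw [this]
  exact (continuous_translate _).comp NNReal.continuous_coe

variable [CompleteSpace k]

variable (k) in
/-- The left shift `s_t^*`. -/
noncomputable def leftShift (t : ℝ≥0) : L2On k (Set.Ici 0) →L[ℂ] L2On k (Set.Ici 0) :=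
  (shift k t).toContinuousLinearMap.adjoint

/-- The left shift is the compression to `L²(ℝ₊; k)` of the translation by `-t`. -/
theorem leftShift_eq (t : ℝ≥0) (f : L2On k (Set.Ici 0)) :
    leftShift k t f =
      (extLine k).toContinuousLinearMap.adjoint (translate k (-t) (extLine k f)) := by
  refine ext_inner_right ℂ fun g => ?_
  rw [leftShift, ContinuousLinearMap.adjoint_inner_left, ContinuousLinearMap.adjoint_inner_left,
    LinearIsometry.coe_toContinuousLinearMap, LinearIsometry.coe_toContinuousLinearMap,
    ← (extLine k).inner_map_map, extLine_shift, ← (translate k (-t)).inner_map_map,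
    ← translate_add, neg_add_cancel, translate_zero]

theorem continuous_leftShift (f : L2On k (Set.Ici 0)) : Continuous fun t => leftShift k t f := by
  simp only [leftShift_eq]
  exact (ContinuousLinearMap.continuous _).comp
    ((continuous_translate _).comp (by fun_prop))

theorem leftShift_shift_add_embPast (t : ℝ≥0) (f : L2On k (Set.Ici 0))
    (g : L2On k (Set.Ico 0 (t : ℝ))) : leftShift k t (shift k t f + embPast k t g) = f := by
  refine ext_inner_left ℂ fun f' => ?_
  rw [leftShift, ContinuousLinearMap.adjoint_inner_right, LinearIsometry.coe_toContinuousLinearMap,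
    inner_add_right, inner_shift_embPast, add_zero, LinearIsometry.inner_map_map]

end Shift

/-! ### The shift semigroup and `σ_t` -/

section Sigma

variable (h k : Type*) [NormedAddCommGroup h] [InnerProductSpace ℂ h]
  [NormedAddCommGroup k] [InnerProductSpace ℂ k]

/-- The ampliated second quantisation `u ⊗ ε(f) ↦ u ⊗ ε(s_t f)` of the right shift, obtained by
putting the vacuum `ε(0)` on `[0, t[`. -/
noncomputable def shiftOp (t : ℝ≥0) : FockPlus h k →L[ℂ] FockPlus h k :=
  (shiftFactor h k t).toContinuousLinearEquiv.toContinuousLinearMap ∘L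
    toHTensor.toContinuousLinearMap ∘L
      (TensorProduct.mkL ℂ (FockPlus h k) (Fock (L2On k (Set.Ico 0 (t : ℝ))))).flip (expVec 0)

variable {h k}

theorem shiftOp_apply (t : ℝ≥0) (ξ : FockPlus h k) :
    shiftOp h k t ξ = shiftFactor h k t (htmul ξ (expVec 0)) := rfl

theorem shiftFactor_htmul (t : ℝ≥0) (u : h) (f : L2On k (Set.Ici 0))
    (g : L2On k (Set.Ico 0 (t : ℝ))) :
    shiftFactor h k t (htmul (htmul u (expVec f)) (expVec g)) =
      htmul u (expVec (shift k t f + embPast k t g)) :=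
  fockSplit_htmul _ _ _ _ _ _ _ _

theorem shiftOp_htmul (t : ℝ≥0) (u : h) (f : L2On k (Set.Ici 0)) :
    shiftOp h k t (htmul u (expVec f)) = htmul u (expVec (shift k t f)) := by
  rw [shiftOp_apply, shiftFactor_htmul, map_zero, add_zero]

theorem norm_shiftOp_le (t : ℝ≥0) : ‖shiftOp h k t‖ ≤ 1 := by
  refine ContinuousLinearMap.opNorm_le_bound _ zero_le_one fun ξ => ?_
  rw [shiftOp_apply, LinearIsometryEquiv.norm_map, norm_htmul, norm_expVec]
  simp

theorem ext_htmul_expVec {A B : FockPlus h k →L[ℂ] FockPlus h k}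
    (hAB : ∀ u f, A (htmul u (expVec f)) = B (htmul u (expVec f))) : A = B := by
  refine ContinuousLinearMap.ext_on (dense_span_htmul_expVec h) ?_
  rintro _ ⟨⟨u, f⟩, rfl⟩
  exact hAB u f

theorem shiftOp_add (r t : ℝ≥0) : shiftOp h k (r + t) = shiftOp h k r * shiftOp h k t := by
  refine ext_htmul_expVec fun u f => ?_
  rw [mul_apply_eq_comp, shiftOp_htmul, shiftOp_htmul, shiftOp_htmul, shift_add]

theorem tendsto_shiftOp (ξ : FockPlus h k) :
    Tendsto (fun t => shiftOp h k t ξ) (𝓝[>] 0) (𝓝 ξ) := by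
  refine tendsto_apply_of_dense_span (B := 1) (dense_span_htmul_expVec h)
    (Eventually.of_forall norm_shiftOp_le) ?_ ξ
  rintro _ ⟨⟨u, f⟩, rfl⟩
  simp only [shiftOp_htmul, one_apply_eq_self]
  have hc : Continuous fun t => htmul u (expVec (shift k t f)) :=
    (continuous_htmul_right u).comp (continuous_expVec.comp (continuous_shift f))
  simpa only [shift_zero] using (hc.tendsto 0).mono_left nhdsWithin_le_nhds

theorem sigma_shiftFactor (t : ℝ≥0) (Z : FockPlus h k →L[ℂ] FockPlus h k)
    (ξ : FockPlus h k) (η : Fock (L2On k (Set.Ico 0 (t : ℝ)))) :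
    sigma t Z (shiftFactor h k t (htmul ξ η)) = shiftFactor h k t (htmul (Z ξ) η) := by
  change shiftFactor h k t (ampl _ Z ((shiftFactor h k t).symm (shiftFactor h k t _))) = _
  rw [LinearIsometryEquiv.symm_apply_apply, ampl_htmul]

theorem norm_sigma_le (t : ℝ≥0) (Z : FockPlus h k →L[ℂ] FockPlus h k) :
    ‖sigma t Z‖ ≤ ‖Z‖ := by
  refine ContinuousLinearMap.opNorm_le_bound _ (norm_nonneg _) fun ξ => ?_
  change ‖shiftFactor h k t (ampl _ Z ((shiftFactor h k t).symm ξ))‖ ≤ _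
  rw [LinearIsometryEquiv.norm_map, ← LinearIsometryEquiv.norm_map (shiftFactor h k t).symm ξ]
  exact (ampl _ Z).le_of_opNorm_le (norm_ampl_le Z) _

/-- The intertwining relation behind the semigroup property of `t ↦ X_t S_t`. -/
theorem sigma_mul_shiftOp (t : ℝ≥0) (Z : FockPlus h k →L[ℂ] FockPlus h k) :
    sigma t Z * shiftOp h k t = shiftOp h k t * Z := by
  ext ξ
  rw [mul_apply_eq_comp, mul_apply_eq_comp, shiftOp_apply,
    sigma_shiftFactor, shiftOp_apply]

/-- On `u ⊗ ε(f)` the operator `σ_t(Z)` only sees `u ⊗ ε(s_t^* f)`: the factor `ε(f|_{[0,t[})`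
splits off, and its norm is at most that of `ε(f)`. -/
theorem norm_sigma_htmul_sub_le [CompleteSpace k] (t : ℝ≥0)
    (Z : FockPlus h k →L[ℂ] FockPlus h k) (u : h) (f : L2On k (Set.Ici 0)) :
    ‖sigma t Z (htmul u (expVec f)) - htmul u (expVec f)‖ ≤
      ‖Z (htmul u (expVec (leftShift k t f))) - htmul u (expVec (leftShift k t f))‖ *
        ‖expVec f‖ := by
  obtain ⟨f₁, f₂, rfl⟩ := exists_shift_add_embPast t f
  rw [leftShift_shift_add_embPast, ← shiftFactor_htmul, sigma_shiftFactor, ← map_sub,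
    ← htmul_sub_left, LinearIsometryEquiv.norm_map, norm_htmul]
  gcongr
  have h1 := norm_add_sq (𝕜 := ℂ) (shift k t f₁) (embPast k t f₂)
  rw [inner_shift_embPast, LinearIsometry.norm_map, LinearIsometry.norm_map, map_zero] at h1
  rw [norm_expVec, norm_expVec]
  gcongr
  exact (pow_le_pow_iff_left₀ (norm_nonneg _) (norm_nonneg _) two_ne_zero).1
    (by rw [h1]; nlinarith [sq_nonneg ‖f₁‖])

end Sigma
/-! ### Left cocycles -/

section Cocycle

variable {h k : Type*} [NormedAddCommGroup h] [InnerProductSpace ℂ h]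
  [NormedAddCommGroup k] [InnerProductSpace ℂ k]
  {X : ℝ≥0 → (FockPlus h k →L[ℂ] FockPlus h k)}

theorem IsLeftCocycle.norm_apply_add_le (hX : IsLeftCocycle X) (r t : ℝ≥0) :
    ‖X (r + t)‖ ≤ ‖X r‖ * ‖X t‖ := by
  rw [hX.add]
  exact (norm_mul_le _ _).trans (mul_le_mul_of_nonneg_left (norm_sigma_le r _) (norm_nonneg _))

/-- The operators `X_t S_t` form a semigroup. -/
theorem IsLeftCocycle.mul_shiftOp_add (hX : IsLeftCocycle X) (r t : ℝ≥0) :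
    X (r + t) * shiftOp h k (r + t) = (X r * shiftOp h k r) * (X t * shiftOp h k t) := by
  rw [hX.add, shiftOp_add, mul_assoc, ← mul_assoc (sigma r (X t)), sigma_mul_shiftOp]
  simp only [mul_assoc]

theorem IsLeftCocycle.exists_norm_le_mul_exp (hX : IsLeftCocycle X) (hw : TendstoWeaklyId X) :
    ∃ M a : ℝ, ∀ t : ℝ≥0, ‖X t‖ ≤ M * Real.exp (a * t) := by
  obtain ⟨δ, hδ, C, hC⟩ := exists_norm_le_of_tendsto_inner hw
  exact exists_le_mul_exp (fun _ => norm_nonneg _) hX.norm_apply_add_le hδ hC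

theorem IsLeftCocycle.exists_norm_le (hX : IsLeftCocycle X) (hw : TendstoWeaklyId X)
    (T : ℝ≥0) : ∃ M : ℝ, 0 ≤ M ∧ ∀ t ≤ T, ‖X t‖ ≤ M := by
  obtain ⟨M, a, hM⟩ := hX.exists_norm_le_mul_exp hw
  refine ⟨|M| * Real.exp (|a| * T), by positivity, fun t ht => (hM t).trans ?_⟩
  gcongr
  · exact le_abs_self M
  · exact le_abs_self a

/-- Strong continuity at `0`: the semigroup `X_t S_t` is weakly, hence strongly, continuous at `0`,
and the difference `X_t ξ - X_t S_t ξ` vanishes in the limit. -/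
theorem IsLeftCocycle.tendsto_zero (hX : IsLeftCocycle X) (hw : TendstoWeaklyId X)
    (ξ : FockPlus h k) : Tendsto (fun t => X t ξ) (𝓝 0) (𝓝 ξ) := by
  obtain ⟨M, hM0, hM⟩ := hX.exists_norm_le hw 1
  have hdiff : ∀ η : FockPlus h k,
      Tendsto (fun t => X t (shiftOp h k t η) - X t η) (𝓝[>] 0) (𝓝 0) := by
    intro η
    refine squeeze_zero_norm' (a := fun t => M * ‖shiftOp h k t η - η‖) ?_ ?_
    · filter_upwards [nhdsWithin_le_nhds (Iio_mem_nhds (zero_lt_one (α := ℝ≥0)))] with t ht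
      rw [← map_sub]
      exact (X t).le_of_opNorm_le (hM t (le_of_lt ht)) _
    · simpa using (tendsto_iff_norm_sub_tendsto_zero.1 (tendsto_shiftOp η)).const_mul M
  have hP : Tendsto (fun t => (X t * shiftOp h k t) ξ) (𝓝[>] 0) (𝓝 ξ) := by
    refine tendsto_apply_of_semigroup_of_tendsto_inner hX.mul_shiftOp_add (fun T => ?_)
      (fun ζ η => ?_) ξ
    · obtain ⟨M, hM0, hM⟩ := hX.exists_norm_le hw T
      refine ⟨M * 1, fun t ht => (norm_mul_le _ _).trans ?_⟩
      exact mul_le_mul (hM t ht) (norm_shiftOp_le t) (norm_nonneg _) hM0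
    · have h1 := (hw ζ η).add ((tendsto_const_nhds (x := ζ)).inner (hdiff η) (𝕜 := ℂ))
      simpa [inner_sub_right] using h1
  have h1 : Tendsto (fun t => X t ξ) (𝓝[>] 0) (𝓝 ξ) := by simpa using hP.sub (hdiff ξ)
  have h2 : Tendsto (fun t => X t ξ) (pure 0) (𝓝 ξ) := by
    simpa [hX.zero] using tendsto_pure_nhds (fun t => X t ξ) (0 : ℝ≥0)
  have h3 : 𝓝 (0 : ℝ≥0) = pure 0 ⊔ 𝓝[>] 0 := by
    rw [← pure_sup_nhdsNE]
    congr 2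
    ext t
    simp [pos_iff_ne_zero]
  rw [h3]
  exact h2.sup h1

theorem IsLeftCocycle.norm_sub_htmul_le [CompleteSpace k] (hX : IsLeftCocycle X) (r s : ℝ≥0)
    (u : h) (f : L2On k (Set.Ici 0)) :
    ‖X (r + s) (htmul u (expVec f)) - X r (htmul u (expVec f))‖ ≤ ‖X r‖ *
      (‖X s (htmul u (expVec (leftShift k r f))) - htmul u (expVec (leftShift k r f))‖ *
        ‖expVec f‖) := by
  rw [hX.add, mul_apply_eq_comp, ← map_sub]
  exact (X r).le_opNorm_of_le (norm_sigma_htmul_sub_le r (X s) u f)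

theorem IsLeftCocycle.continuous_apply [CompleteSpace k] (hX : IsLeftCocycle X)
    (hw : TendstoWeaklyId X) (ξ : FockPlus h k) : Continuous fun t => X t ξ := by
  refine continuous_iff_continuousAt.2 fun t => ?_
  obtain ⟨M, hM0, hM⟩ := hX.exists_norm_le hw (t + 1)
  have hlt : ∀ᶠ q in 𝓝 t, q < t + 1 := Iio_mem_nhds (lt_add_of_pos_right t one_pos)
  refine tendsto_apply_of_dense_span (dense_span_htmul_expVec h)
    (hlt.mono fun q hq => hM q hq.le) ?_ ξ
  rintro _ ⟨⟨u, f⟩, rfl⟩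
  rw [tendsto_iff_norm_sub_tendsto_zero]
  -- treat both sides of `t` at once: compare the times `min q t` and `max q t`
  let v : ℝ≥0 → FockPlus h k := fun q => htmul u (expVec (leftShift k (min q t) f))
  let s : ℝ≥0 → ℝ≥0 := fun q => max q t - min q t
  have hv : Tendsto v (𝓝 t) (𝓝 (v t)) := by
    have : Continuous v := (continuous_htmul_right u).comp (continuous_expVec.comp
      ((continuous_leftShift f).comp (by fun_prop)))
    exact this.tendsto t
  have hs : Tendsto s (𝓝 t) (𝓝 0) := by
    have : Continuous s := by fun_prop
    simpa [s] using this.tendsto t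
  have hs1 : ∀ᶠ q in 𝓝 t, s q < 1 := hs.eventually (Iio_mem_nhds one_pos)
  have hbound : ∀ᶠ q in 𝓝 t, ‖X q (htmul u (expVec f)) - X t (htmul u (expVec f))‖ ≤
      M * (((M + 1) * ‖v q - v t‖ + ‖X (s q) (v t) - v t‖) * ‖expVec f‖) := by
    filter_upwards [hs1] with q hq
    have h1 : ‖X q (htmul u (expVec f)) - X t (htmul u (expVec f))‖ ≤
        ‖X (min q t)‖ * (‖X (s q) (v q) - v q‖ * ‖expVec f‖) := by
      have h2 := hX.norm_sub_htmul_le (min q t) (s q) u f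
      rw [add_tsub_cancel_of_le min_le_max] at h2
      rcases le_total q t with hqt | hqt
      · rw [max_eq_right hqt, min_eq_left hqt] at h2
        rw [norm_sub_rev]
        simpa only [v, min_eq_left hqt] using h2
      · rw [max_eq_left hqt, min_eq_right hqt] at h2
        simpa only [v, min_eq_right hqt] using h2
    have h3 : ‖X (s q) (v q) - v q‖ ≤ (M + 1) * ‖v q - v t‖ + ‖X (s q) (v t) - v t‖ := by
      have h4 : X (s q) (v q) - v q =
          X (s q) (v q - v t) + (X (s q) (v t) - v t) - (v q - v t) := by
        rw [map_sub]; abel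
      have h5 : ‖X (s q) (v q - v t)‖ ≤ M * ‖v q - v t‖ :=
        (X (s q)).le_of_opNorm_le (hM _ (hq.le.trans (by simp))) _
      rw [h4]
      refine (norm_sub_le _ _).trans ?_
      linarith [norm_add_le (X (s q) (v q - v t)) (X (s q) (v t) - v t)]
    refine h1.trans ?_
    gcongr
    exact hM _ ((min_le_right q t).trans (by simp))
  refine squeeze_zero' (Eventually.of_forall fun _ => norm_nonneg _) hbound ?_
  have l1 := (tendsto_iff_norm_sub_tendsto_zero.1 hv).const_mul (M + 1)
  have l2 := tendsto_iff_norm_sub_tendsto_zero.1 ((hX.tendsto_zero hw (v t)).comp hs)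
  simpa using ((l1.add l2).mul_const ‖expVec f‖).const_mul M

end Cocycle
end QSC

theorem proposition2p1
    {h k : Type*}
    [NormedAddCommGroup h] [InnerProductSpace ℂ h] [CompleteSpace h]
    [NormedAddCommGroup k] [InnerProductSpace ℂ k] [CompleteSpace k]
    (X : ℝ≥0 → (QSC.FockPlus h k →L[ℂ] QSC.FockPlus h k))
    (hX : QSC.IsLeftCocycle X)
    (hweak : QSC.TendstoWeaklyId X) :
    (∃ M a : ℝ, ∀ t : ℝ≥0, ‖X t‖ ≤ M * Real.exp (a * t)) ∧
      ∀ ξ : QSC.FockPlus h k, Continuous fun t : ℝ≥0 => X t ξ :=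
  ⟨hX.exists_norm_le_mul_exp hweak, hX.continuous_apply hweak⟩
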